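/- Let $\kappa$ be a singular cardinal of countable cofinality and let $\tau$ be a relational vocabulary with countably many relation symbols, each of (possibly infinite) arity $<\kappa$. Models are non-empty $\tau$-structures. For cardinals $\lambda,\theta$, the sentences of $L_{\lambda,\theta}$ are those without free variables that are built from atomic formulas (including equalities) by negation, conjunctions and disjunctions of fewer than $\lambda$ formulas, and existential quantification over strings of fewer than $\theta$ variables; $\models$ is the usual truth relation, and $L_{\lambda,\theta}$ also denotes the logic $(L_{\lambda,\theta},\models,\mathcal M)$, where $\mathcal M$ is the class of all models. A *weak chain model* is a model $A$ with a sequence $(A_n)_{n<\omega}$ of subsets such that $A_n\subseteq A_{n+1}$ for all $n$ and $A=\bigcup_{n<\omega}A_n$; its size is $|A|$. It is a *proper chain model* if $|A_n|<|A_{n+1}|$ for all $n$. The relation $\models^c$ between weak chain models and formulas is defined like $\models$, except that $(A_n)_{n<\omega}\models^c\exists\bar x\,\varphi(\bar x)$ iff there are $n<\omega$ and a sequence $\bar a$ of elements of $A_n$, of the same length as $\bar x$, with $(A_n)_{n<\omega}\models^c\varphi[\bar a]$. Let $L^{c,*}_{\kappa,\kappa}$ be the logic with the sentences of $L_{\kappa,\kappa}$,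 the relation $\models^c$ and all weak chain models, and let $L^{c}_{\kappa,\kappa}$ be the same with only the proper chain models. For logics $(L,\models,S)$ and $(L',\models',S')$ (sentences, truth relation, class of models), write $(L,\models,S)\le(L',\models',S')$ if there are maps $f:L\to L'$ and $g:S'\to S$ such that $s'\models' f(\varphi)\iff g(s')\models\varphi$ for all $\varphi\in L$, $s'\in S'$, and such that for every $\varphi\in L$ that is true in some $s\in S$ there is $s'\in S'$ with $g(s')\models\varphi$. Then: 1. $L_{\kappa,\omega}\le L^{c,*}_{\kappa,\kappa}$. 2. If $\kappa$ is a strong limit cardinal, then $(L_{\kappa,\omega},\models,\mathcal M_{\ge\kappa})\le L^{c}_{\kappa,\kappa}$, where $\mathcal M_{\ge\kappa}$ is the class of models of size $\ge\kappa$. 3. $(L_{\kappa,\kappa},\models^c,\mathcal M^{c}_{\ge\kappa})\le L^{c}_{\kappa,\kappa}$, where $\mathcal M^{c}_{\ge\kappa}$ is the class of weak chain models of size $\ge\kappa$. -/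

import Mathlib

open Cardinal

universe u v v'

namespace ChainLogic

/-! ### Abstract logics and Chu transforms -/

/-- An abstract logic: a class of sentences, a class of models and a satisfaction relation.
The classes may be proper classes, so they live in an arbitrary universe. (The notion of isomorphism
that accompanies the models plays no role in the comparison of logics below, so it is not part of
the data.) -/
structure AbstractLogic where
  /-- the sentences -/
  Sentence : Type v
  /-- the models -/
  Model : Type v
  /-- the satisfaction relation -/
  Sat : Model → Sentence → Prop

/-- A Chu transform between two logics, viewed as two-valued Chu spaces: sentences are mapped
forwards, models are mapped backwards, and the two maps are adjoint. -/
structure ChuTransform (L : AbstractLogic.{v}) (L' : AbstractLogic.{v'}) where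
  /-- the map on sentences -/
  f : L.Sentence → L'.Sentence
  /-- the map on models -/
  g : L'.Model → L.Model
  adjoint : ∀ (φ : L.Sentence) (s' : L'.Model), L'.Sat s' (f φ) ↔ L.Sat (g s') φ

/-- The range of `g` is dense: every sentence that has a model has a model in the range of `g`. -/
def ChuTransform.IsDense {L : AbstractLogic.{v}} {L' : AbstractLogic.{v'}}
    (T : ChuTransform L L') : Prop :=
  ∀ φ : L.Sentence, (∃ s : L.Model, L.Sat s φ) → ∃ s' : L'.Model, L.Sat (T.g s') φ

/-- `L ≤ L'` in the Chu order. -/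
def AbstractLogic.ChuLE (L : AbstractLogic.{v}) (L' : AbstractLogic.{v'}) : Prop :=
  ∃ T : ChuTransform L L', T.IsDense

/-! ### Vocabularies, models, chain models -/

/-- A relational vocabulary. The arity of a symbol is an index type (possibly infinite): a symbol
of arity `I` is interpreted by a set of `I`-indexed tuples. -/
structure Vocabulary where
  /-- the relation symbols -/
  Rel : Type u
  /-- the arities -/
  arity : Rel → Type u

/-- An ordinary model of a vocabulary: a nonempty set with interpretations of the symbols. -/
structure OrdModel (τ : Vocabulary.{u}) where
  /-- the universe of the model -/
  carrier : Type u
  nonempty : Nonempty carrier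
  /-- the interpretation of the relation symbols -/
  rel : ∀ R : τ.Rel, (τ.arity R → carrier) → Prop

/-- A weak chain model: a model with an increasing `ω`-sequence of subsets whose union is the
whole model. -/
structure WeakChainModel (τ : Vocabulary.{u}) extends OrdModel τ where
  /-- the chain -/
  chain : ℕ → Set carrier
  chain_subset_succ : ∀ n, chain n ⊆ chain (n + 1)
  iUnion_chain : ⋃ n, chain n = Set.univ

/-- A weak chain model is proper if the cardinalities of the members of its chain are strictly
increasing. -/
def WeakChainModel.IsProper {τ : Vocabulary.{u}} (M : WeakChainModel τ) : Prop :=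
  ∀ n, #(M.chain n) < #(M.chain (n + 1))

/-! ### Infinitary formulas -/

/-- Formulas of `L_{lam, θ}` with free variables among `α`: built from atomic formulas (equalities
included) by negation, conjunctions and disjunctions of fewer than `lam` formulas, and
existential quantification over a string of fewer than `θ` variables. A string is indexed by a
type `ι`; in the scope of the quantifier the available variables are those in `α ⊕ ι`. -/
inductive Formula (τ : Vocabulary.{u}) (lam θ : Cardinal.{u}) : Type u → Type (u + 1)
  | eq {α : Type u} (x y : α) : Formula τ lam θ α
  | rel {α : Type u} (R : τ.Rel) (x : τ.arity R → α) : Formula τ lam θ α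
  | neg {α : Type u} (φ : Formula τ lam θ α) : Formula τ lam θ α
  | conj {α : Type u} (ι : Type u) (hι : #ι < lam) (φ : ι → Formula τ lam θ α) : Formula τ lam θ α
  | disj {α : Type u} (ι : Type u) (hι : #ι < lam) (φ : ι → Formula τ lam θ α) : Formula τ lam θ α
  | ex {α : Type u} (ι : Type u) (hι : #ι < θ) (φ : Formula τ lam θ (α ⊕ ι)) : Formula τ lam θ α

/-- Sentences of `L_{lam, θ}`: formulas without free variables. -/
abbrev Sentence (τ : Vocabulary.{u}) (lam θ : Cardinal.{u}) : Type (u + 1) :=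
  Formula τ lam θ PEmpty.{u + 1}

/-- The ordinary truth definition, under an assignment `a` of the free variables. -/
def Formula.Realize {τ : Vocabulary.{u}} {lam θ : Cardinal.{u}} (M : OrdModel τ) :
    {α : Type u} → Formula τ lam θ α → (α → M.carrier) → Prop
  | _, .eq x y, a => a x = a y
  | _, .rel R x, a => M.rel R fun i => a (x i)
  | _, .neg φ, a => ¬ φ.Realize M a
  | _, .conj _ _ φ, a => ∀ i, (φ i).Realize M a
  | _, .disj _ _ φ, a => ∃ i, (φ i).Realize M a
  | _, .ex ι _ φ, a => ∃ b : ι → M.carrier, φ.Realize M (Sum.elim a b)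

/-- The truth definition in chain models: the witnesses for a string of quantifiers have to lie
together in one member of the chain. -/
def Formula.ChainRealize {τ : Vocabulary.{u}} {lam θ : Cardinal.{u}} (M : WeakChainModel τ) :
    {α : Type u} → Formula τ lam θ α → (α → M.carrier) → Prop
  | _, .eq x y, a => a x = a y
  | _, .rel R x, a => M.rel R fun i => a (x i)
  | _, .neg φ, a => ¬ φ.ChainRealize M a
  | _, .conj _ _ φ, a => ∀ i, (φ i).ChainRealize M a
  | _, .disj _ _ φ, a => ∃ i, (φ i).ChainRealize M a
  | _, .ex ι _ φ, a => ∃ n : ℕ, ∃ b : ι → M.carrier,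
      (∀ i, b i ∈ M.chain n) ∧ φ.ChainRealize M (Sum.elim a b)

/-- Truth of a sentence in an ordinary model. -/
def OrdModel.Models {τ : Vocabulary.{u}} {lam θ : Cardinal.{u}} (M : OrdModel τ)
    (φ : Sentence τ lam θ) : Prop :=
  φ.Realize M PEmpty.elim

/-- Truth of a sentence in a chain model. -/
def WeakChainModel.Models {τ : Vocabulary.{u}} {lam θ : Cardinal.{u}} (M : WeakChainModel τ)
    (φ : Sentence τ lam θ) : Prop :=
  φ.ChainRealize M PEmpty.elim

/-! ### The logics -/

/-- `L_{lam, θ}` with the ordinary truth definition, on the class of models satisfying `K`. -/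
def ordLogicOn (τ : Vocabulary.{u}) (lam θ : Cardinal.{u}) (K : OrdModel τ → Prop) :
    AbstractLogic.{u + 1} where
  Sentence := Sentence τ lam θ
  Model := {M : OrdModel τ // K M}
  Sat M φ := M.1.Models φ

/-- `L_{lam, θ}` with the chain truth definition, on the class of weak chain models satisfying
`K`. -/
def chainLogicOn (τ : Vocabulary.{u}) (lam θ : Cardinal.{u}) (K : WeakChainModel τ → Prop) :
    AbstractLogic.{u + 1} where
  Sentence := Sentence τ lam θ
  Model := {M : WeakChainModel τ // K M}
  Sat M φ := M.1.Models φ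

/-- The ordinary infinitary logic `L_{lam, θ}`, on all models. -/
def ordLogic (τ : Vocabulary.{u}) (lam θ : Cardinal.{u}) : AbstractLogic.{u + 1} :=
  ordLogicOn τ lam θ fun _ => True

/-- `L_{lam, θ}` on the class of models of size at least `lam`. -/
def bigOrdLogic (τ : Vocabulary.{u}) (lam θ : Cardinal.{u}) : AbstractLogic.{u + 1} :=
  ordLogicOn τ lam θ fun M => lam ≤ #M.carrier

/-- The weak chain logic `L^{c,*}_{lam, θ}`: all weak chain models. -/
def weakChainLogic (τ : Vocabulary.{u}) (lam θ : Cardinal.{u}) : AbstractLogic.{u + 1} :=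
  chainLogicOn τ lam θ fun _ => True

/-- Weak chain logic on the class of weak chain models of size at least `lam`. -/
def bigWeakChainLogic (τ : Vocabulary.{u}) (lam θ : Cardinal.{u}) :
    AbstractLogic.{u + 1} :=
  chainLogicOn τ lam θ fun M => lam ≤ #M.carrier

/-- The chain logic `L^c_{lam, θ}`: all proper chain models. -/
def chainLogic (τ : Vocabulary.{u}) (lam θ : Cardinal.{u}) : AbstractLogic.{u + 1} :=
  chainLogicOn τ lam θ WeakChainModel.IsProper

end ChainLogic

namespace ChainLogic

/-! ### The Chu order -/

/-! A finite string lies in a single member of a chain, so on `L_{κ,ω}` chain truth is ordinary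
truth, and constant chains turn every model into a weak chain model. This gives the first claim;
restricted to size at least `κ` and composed with the third, it gives the second.

For the third claim, a proper chain model `N` is sent to the weak chain model that an interpretation
defines in it, or to a fixed model `M₀` if the defined domain has fewer than `κ` elements. Chain
logic can tell the two cases apart: since `κ` is singular, "size at least `κ`" is a conjunction of
fewer than `κ` sentences, each asking for fewer than `κ` distinct elements in one chain member.
Sentences are pulled back by relativization.

Density requires each `M` of size at least `κ` to be padded to a proper chain model whose
interpreted model satisfies the same sentence. If some arity has two places, mixed tuples of old and
new elements mark the old ones (`chuLE_of_nontrivial_arity`). If infinitely many symbols are unary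
and none has larger arity, shifting them frees one to name the old part (`chuLE_of_infinite_unary`).
If only finitely many are unary, no coding is needed: some type is realized `κ` times, and adding
clones of it gives an elementary extension (`Formula.chainRealize_padType`). -/

theorem AbstractLogic.ChuLE.trans {L₁ L₂ L₃ : AbstractLogic} (h₁ : L₁.ChuLE L₂)
    (h₂ : L₂.ChuLE L₃) : L₁.ChuLE L₃ := by
  obtain ⟨T, hT⟩ := h₁
  obtain ⟨U, hU⟩ := h₂
  refine ⟨⟨U.f ∘ T.f, T.g ∘ U.g, fun φ s => ?_⟩, fun φ hφ => ?_⟩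
  · exact (U.adjoint _ _).trans (T.adjoint _ _)
  · obtain ⟨s, hs⟩ := hT φ hφ
    obtain ⟨t, ht⟩ := hU (T.f φ) ⟨s, (T.adjoint _ _).2 hs⟩
    exact ⟨t, (T.adjoint _ _).1 ht⟩

/-! ### Chains -/

variable {τ : Vocabulary.{u}} {κ lam θ θ' : Cardinal.{u}}

theorem WeakChainModel.chain_mono (M : WeakChainModel τ) : Monotone M.chain :=
  monotone_nat_of_le_succ M.chain_subset_succ

theorem WeakChainModel.exists_mem_chain (M : WeakChainModel τ) (x : M.carrier) :
    ∃ n, x ∈ M.chain n := by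
  simpa using (M.iUnion_chain.symm ▸ Set.mem_univ x : x ∈ ⋃ n, M.chain n)

theorem WeakChainModel.exists_forall_mem_chain (M : WeakChainModel τ) {ι : Type*} [Finite ι]
    (b : ι → M.carrier) : ∃ n, ∀ i, b i ∈ M.chain n := by
  choose n hn using fun i => M.exists_mem_chain (b i)
  obtain ⟨m, hm⟩ := (Set.finite_range n).bddAbove
  exact ⟨m, fun i => M.chain_mono (hm ⟨i, rfl⟩) (hn i)⟩

/-- If a set has size at least `κ`, then the sizes of its intersections with the chain are not
bounded below `κ`. -/
theorem WeakChainModel.exists_lt_mk_inter (M : WeakChainModel τ) (hκ : ℵ₀ < κ)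
    {S : Set M.carrier} (hS : κ ≤ #S) {μ : Cardinal.{u}} (hμ : μ < κ) :
    ∃ n, μ < #(M.chain n ∩ S : Set M.carrier) := by
  by_contra! h
  have hU : S = ⋃ n : ULift.{u} ℕ, M.chain n.down ∩ S := by
    ext x
    obtain ⟨n, hn⟩ := M.exists_mem_chain x
    simp only [Set.mem_iUnion, Set.mem_inter_iff]
    exact ⟨fun hx => ⟨⟨n⟩, hn, hx⟩, fun ⟨_, hx⟩ => hx.2⟩
  have h₁ : #S ≤ ℵ₀ * μ := by
    rw [hU]
    refine (mk_iUnion_le _).trans ?_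
    gcongr
    · simp
    · exact ciSup_le' fun n => h n.down
  -- A countable union of sets of size at most `μ` cannot reach `κ`, as `κ` is uncountable.
  exact absurd (hS.trans h₁) (not_le.2 (mul_lt_of_lt hκ.le hκ hμ))

/-! ### The ordinary logic in the chain logic -/

/-- A formula of `L_{lam, θ}` as a formula of `L_{lam, θ'}`. -/
def Formula.weaken (h : θ ≤ θ') : {α : Type u} → Formula τ lam θ α → Formula τ lam θ' α
  | _, .eq x y => .eq x y
  | _, .rel R x => .rel R x
  | _, .neg φ => .neg (φ.weaken h)
  | _, .conj ι hι φ => .conj ι hι fun i => (φ i).weaken h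
  | _, .disj ι hι φ => .disj ι hι fun i => (φ i).weaken h
  | _, .ex ι hι φ => .ex ι (hι.trans_le h) (φ.weaken h)

theorem Formula.chainRealize_weaken (h : ℵ₀ ≤ θ') (M : WeakChainModel τ) {α : Type u}
    (φ : Formula τ lam ℵ₀ α) (a : α → M.carrier) :
    (φ.weaken h).ChainRealize M a ↔ φ.Realize M.toOrdModel a := by
  induction φ with
  | eq x y => rfl
  | rel R x => rfl
  | neg φ ih => exact not_congr (ih a)
  | conj ι hι φ ih => exact forall_congr' fun i => ih i a
  | disj ι hι φ ih => exact exists_congr fun i => ih i a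
  | ex ι hι φ ih =>
    have := mk_lt_aleph0_iff.1 hι
    simp only [weaken, ChainRealize, Realize, ih]
    exact ⟨fun ⟨_, b, _, hb⟩ => ⟨b, hb⟩, fun ⟨b, hb⟩ =>
      (M.exists_forall_mem_chain b).imp fun n hn => ⟨b, hn, hb⟩⟩

/-- An ordinary model, with the chain all of whose members are the whole model. -/
def OrdModel.toWeakChainModel (M : OrdModel τ) : WeakChainModel τ where
  toOrdModel := M
  chain _ := Set.univ
  chain_subset_succ _ := subset_rfl
  iUnion_chain := Set.iUnion_const _

theorem ordLogicOn_chuLE_chainLogicOn (h : ℵ₀ ≤ θ) (K : OrdModel τ → Prop) :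
    (ordLogicOn τ lam ℵ₀ K).ChuLE (chainLogicOn τ lam θ fun M => K M.toOrdModel) :=
  ⟨⟨Formula.weaken h, fun M => ⟨M.1.toOrdModel, M.2⟩,
    fun φ M => Formula.chainRealize_weaken h M.1 φ _⟩,
    fun _ ⟨M, hM⟩ => ⟨⟨M.1.toWeakChainModel, M.2⟩, hM⟩⟩

/-! ### Isomorphisms of chain models -/

/-- The truth definition in chain models is invariant under bijections that preserve the relations
and the family of sets bounded by a member of the chain. -/
theorem Formula.chainRealize_equiv {M N : WeakChainModel τ} (e : M.carrier ≃ N.carrier)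
    (hrel : ∀ R x, N.rel R (e ∘ x) ↔ M.rel R x)
    (h₁ : ∀ n, ∃ m, ∀ x ∈ M.chain n, e x ∈ N.chain m)
    (h₂ : ∀ n, ∃ m, ∀ x, e x ∈ N.chain n → x ∈ M.chain m)
    {α : Type u} (φ : Formula τ lam θ α) (a : α → M.carrier) :
    φ.ChainRealize N (e ∘ a) ↔ φ.ChainRealize M a := by
  induction φ with
  | eq x y => exact e.apply_eq_iff_eq
  | rel R x => exact hrel R fun i => a (x i)
  | neg φ ih => exact not_congr (ih a)
  | conj ι hι φ ih => exact forall_congr' fun i => ih i a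
  | disj ι hι φ ih => exact exists_congr fun i => ih i a
  | ex ι hι φ ih =>
    constructor
    · rintro ⟨n, b, hb, hφ⟩
      obtain ⟨m, hm⟩ := h₂ n
      refine ⟨m, e.symm ∘ b, fun i => hm _ (by simpa using hb i), (ih _).1 ?_⟩
      rw [Sum.comp_elim]
      simpa [← Function.comp_assoc] using hφ
    · rintro ⟨n, b, hb, hφ⟩
      obtain ⟨m, hm⟩ := h₁ n
      refine ⟨m, e ∘ b, fun i => hm _ (hb i), ?_⟩
      rw [← Sum.comp_elim]
      exact (ih _).2 hφ

theorem WeakChainModel.models_iff_of_equiv {M N : WeakChainModel τ} (e : M.carrier ≃ N.carrier)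
    (hrel : ∀ R x, N.rel R (e ∘ x) ↔ M.rel R x)
    (h₁ : ∀ n, ∃ m, ∀ x ∈ M.chain n, e x ∈ N.chain m)
    (h₂ : ∀ n, ∃ m, ∀ x, e x ∈ N.chain n → x ∈ M.chain m)
    (φ : Sentence τ lam θ) : N.Models φ ↔ M.Models φ := by
  have := Formula.chainRealize_equiv e hrel h₁ h₂ φ PEmpty.elim
  rwa [Subsingleton.elim (e ∘ PEmpty.elim) PEmpty.elim] at this

/-! ### Interpretations -/

/-- An interpretation of weak chain models in weak chain models: a formula defining the domain,
and formulas defining the relations. -/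
structure Interpretation (τ : Vocabulary.{u}) (κ : Cardinal.{u}) where
  /-- the formula defining the domain -/
  domFormula : ∀ {α : Type u}, α → Formula τ κ κ α
  /-- the formulas defining the relations -/
  relFormula : ∀ {α : Type u} (R : τ.Rel), (τ.arity R → α) → Formula τ κ κ α
  /-- the domain -/
  dom : ∀ N : WeakChainModel τ, Set N.carrier
  /-- the relations -/
  rel : ∀ (N : WeakChainModel τ) (R : τ.Rel), (τ.arity R → N.carrier) → Prop
  realize_dom : ∀ (N : WeakChainModel τ) {α : Type u} (x : α) (a : α → N.carrier),
    (domFormula x).ChainRealize N a ↔ a x ∈ dom N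
  realize_rel : ∀ (N : WeakChainModel τ) {α : Type u} (R : τ.Rel) (x : τ.arity R → α)
    (a : α → N.carrier), (relFormula R x).ChainRealize N a ↔ rel N R (a ∘ x)

namespace Interpretation

variable (I : Interpretation τ κ)

/-- The model interpreted in `N`. -/
def decode (N : WeakChainModel τ) (h : (I.dom N).Nonempty) : WeakChainModel τ where
  carrier := I.dom N
  nonempty := h.to_subtype
  rel R x := I.rel N R fun i => (x i).1
  chain n := {x | x.1 ∈ N.chain n}
  chain_subset_succ n _ hx := N.chain_subset_succ n hx
  iUnion_chain := by
    ext x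
    simpa using N.exists_mem_chain x.1

/-- The relativization of formulas along an interpretation. -/
def translate (hκ : ℵ₀ ≤ κ) : {α : Type u} → Formula τ κ κ α → Formula τ κ κ α
  | _, .eq x y => .eq x y
  | _, .rel R x => I.relFormula R x
  | _, .neg φ => .neg (translate hκ φ)
  | _, .conj ι hι φ => .conj ι hι fun i => translate hκ (φ i)
  | _, .disj ι hι φ => .disj ι hι fun i => translate hκ (φ i)
  | _, .ex ι hι φ => .ex ι hι (.conj (Option ι)
      (by rw [mk_option]; exact add_lt_of_lt hκ hι (one_lt_aleph0.trans_le hκ))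
      fun o => o.elim (translate hκ φ) fun i => I.domFormula (Sum.inr i))

/-- The chain of the decoded model is the trace of the chain of `N`, so a string of domain elements
is bounded at the same index in both. -/
theorem realize_translate (hκ : ℵ₀ ≤ κ) (N : WeakChainModel τ) (h : (I.dom N).Nonempty)
    {α : Type u} (φ : Formula τ κ κ α) (a : α → I.dom N) :
    (I.translate hκ φ).ChainRealize N (Subtype.val ∘ a) ↔ φ.ChainRealize (I.decode N h) a := by
  induction φ with
  | eq x y => exact Subtype.ext_iff.symm
  | rel R x => exact I.realize_rel N R x _
  | neg φ ih => exact not_congr (ih a)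
  | conj ι hι φ ih => exact forall_congr' fun i => ih i a
  | disj ι hι φ ih => exact exists_congr fun i => ih i a
  | ex ι hι φ ih =>
    simp only [translate, Formula.ChainRealize, Option.forall, Option.elim, I.realize_dom,
      Sum.elim_inr]
    refine exists_congr fun n => ⟨?_, ?_⟩
    · rintro ⟨b, hb, hφ, hd⟩
      refine ⟨fun i => ⟨b i, hd i⟩, hb, (ih _).1 ?_⟩
      convert hφ using 1
      exact Sum.comp_elim _ _ _
    · rintro ⟨b, hb, hφ⟩
      refine ⟨Subtype.val ∘ b, hb, ?_, fun i => (b i).2⟩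
      convert (ih _).2 hφ using 1
      exact (Sum.comp_elim _ _ _).symm

theorem models_translate (hκ : ℵ₀ ≤ κ) (N : WeakChainModel τ) (h : (I.dom N).Nonempty)
    (φ : Sentence τ κ κ) : N.Models (I.translate hκ φ) ↔ (I.decode N h).Models φ := by
  have := I.realize_translate hκ N h φ PEmpty.elim
  rwa [Subsingleton.elim (Subtype.val ∘ PEmpty.elim) PEmpty.elim] at this

open Classical in
/-- The sentence saying that some member of the chain contains a family, indexed by `J`, of
distinct elements of the domain. -/
noncomputable def existsTuple (hκ : ℵ₀ ≤ κ) (J : Type u) (hJ : #J < κ) : Sentence τ κ κ :=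
  -- Diagonal pairs carry membership in the domain, the other pairs distinctness.
  .ex J hJ (.conj (J × J) (by simpa using mul_lt_of_lt hκ hJ hJ) fun p =>
    if p.1 = p.2 then I.domFormula (Sum.inr p.1) else .neg (.eq (Sum.inr p.1) (Sum.inr p.2)))

theorem models_existsTuple (hκ : ℵ₀ ≤ κ) (N : WeakChainModel τ) (J : Type u) (hJ : #J < κ) :
    N.Models (I.existsTuple hκ J hJ) ↔ ∃ n, #J ≤ #(N.chain n ∩ I.dom N : Set N.carrier) := by
  simp only [WeakChainModel.Models, existsTuple, Formula.ChainRealize]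
  refine exists_congr fun n => ⟨?_, ?_⟩
  · rintro ⟨b, hb, hp⟩
    refine mk_le_of_injective (f := fun j => ⟨b j, hb j, ?_⟩) fun i j hij => ?_
    · have := hp (j, j)
      rw [if_pos rfl, I.realize_dom] at this
      exact this
    · by_contra hne
      have := hp (i, j)
      rw [if_neg hne] at this
      exact this (congrArg Subtype.val hij)
  · rintro ⟨f⟩
    refine ⟨fun j => (f j).1, fun j => (f j).2.1, fun p => ?_⟩
    split_ifs with h
    · exact (I.realize_dom N _ _).2 (f p.1).2.2
    · exact fun h' => h (f.injective (Subtype.ext h'))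

end Interpretation

/-- A singular cardinal `κ` is approximated by fewer than `κ` smaller cardinals. -/
theorem exists_cofinal_family (hκ : κ.IsSingular) :
    ∃ (ι : Type u) (J : ι → Type u), #ι < κ ∧ (∀ i, #(J i) < κ) ∧
      ∀ μ, (∀ i, #(J i) ≤ μ) → κ ≤ μ := by
  obtain ⟨s, hs, hsc⟩ := Order.exists_cof_eq κ.ord.ToType
  -- The family consists of the initial segments cut off by a cofinal set of minimal size.
  refine ⟨s, fun x => Set.Iio x.1, ?_, fun x => by simpa using mk_Iio_lt x.1, fun μ hμ => ?_⟩
  · rw [hsc, Ordinal.cof_toType]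
    exact hκ.cof_ord_lt
  · by_contra! hlt
    -- Passing to the successor of `μ` yields a segment strictly larger than `μ`.
    have hlt' : (Order.succ μ).ord < κ.ord := ord_lt_ord.2 (hκ.isSuccLimit.succ_lt hlt)
    obtain ⟨x, hx, hyx⟩ := hs (Ordinal.ToType.mk ⟨_, hlt'⟩)
    have h₁ : Order.succ μ ≤ #(Set.Iio x) := by
      have h₂ := Ordinal.card_le_card (Ordinal.ToType.mk.le_symm_apply.2 hyx)
      rw [card_ord] at h₂
      exact h₂
    exact (Order.lt_succ μ).not_ge (h₁.trans (hμ ⟨x, hx⟩))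

/-! ### Comparing chain logics through an interpretation -/

theorem mk_bool_lt (hκ : ℵ₀ ≤ κ) : #(ULift.{u} Bool) < κ :=
  (lt_aleph0_of_finite _).trans_le hκ

/-- The conjunction of two formulas. -/
def Formula.and (hκ : ℵ₀ ≤ lam) {α : Type u} (φ ψ : Formula τ lam θ α) : Formula τ lam θ α :=
  .conj (ULift.{u} Bool) (mk_bool_lt hκ) fun b => if b.down then φ else ψ

/-- The disjunction of two formulas. -/
def Formula.or (hκ : ℵ₀ ≤ lam) {α : Type u} (φ ψ : Formula τ lam θ α) : Formula τ lam θ α :=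
  .disj (ULift.{u} Bool) (mk_bool_lt hκ) fun b => if b.down then φ else ψ

theorem Formula.models_and (hκ : ℵ₀ ≤ lam) (M : WeakChainModel τ) (φ ψ : Sentence τ lam θ) :
    M.Models (φ.and hκ ψ) ↔ M.Models φ ∧ M.Models ψ := by
  simp [WeakChainModel.Models, Formula.and, ChainRealize, ULift.forall, and_comm]

theorem Formula.models_or (hκ : ℵ₀ ≤ lam) (M : WeakChainModel τ) (φ ψ : Sentence τ lam θ) :
    M.Models (φ.or hκ ψ) ↔ M.Models φ ∨ M.Models ψ := by
  simp [WeakChainModel.Models, Formula.or, ChainRealize, ULift.exists, or_comm]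

/-- The statement that the domain of an interpretation has size at least `κ` is expressible. -/
theorem Interpretation.exists_models_iff_le_mk_dom (I : Interpretation τ κ) (hκ : κ.IsSingular)
    (hκ₀ : ℵ₀ < κ) : ∃ σ : Sentence τ κ κ, ∀ N : WeakChainModel τ,
      N.Models σ ↔ κ ≤ #(I.dom N) := by
  obtain ⟨ι, J, hι, hJ, hcof⟩ := exists_cofinal_family hκ
  refine ⟨.conj ι hι fun i => I.existsTuple hκ₀.le (J i) (hJ i), fun N => ?_⟩
  have : N.Models (.conj ι hι fun i => I.existsTuple hκ₀.le (J i) (hJ i)) ↔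
      ∀ i, ∃ n, #(J i) ≤ #(N.chain n ∩ I.dom N : Set N.carrier) :=
    forall_congr' fun i => I.models_existsTuple hκ₀.le N (J i) (hJ i)
  rw [this]
  refine ⟨fun h => hcof _ fun i => ?_, fun h i => ?_⟩
  · obtain ⟨n, hn⟩ := h i
    exact hn.trans (mk_le_mk_of_subset Set.inter_subset_right)
  · exact (N.exists_lt_mk_inter hκ₀ h (hJ i)).imp fun _ => le_of_lt

theorem exists_weakChainModel_le_mk (τ : Vocabulary.{u}) (hκ : 0 < κ) :
    ∃ M : WeakChainModel τ, κ ≤ #M.carrier :=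
  ⟨OrdModel.toWeakChainModel ⟨κ.out, mk_ne_zero_iff.1 (by simpa using hκ.ne'), fun _ _ => True⟩,
    (mk_out κ).ge⟩

/-- If every sentence with a weak chain model of size at least `κ` has such a model that is
interpreted in a proper chain model, then the logics are comparable. -/
theorem Interpretation.bigWeakChainLogic_chuLE_chainLogic (I : Interpretation τ κ)
    (hκ : κ.IsSingular) (hκ₀ : ℵ₀ < κ)
    (H : ∀ (φ : Sentence τ κ κ) (M : WeakChainModel τ), κ ≤ #M.carrier → M.Models φ →
      ∃ N : WeakChainModel τ, N.IsProper ∧ κ ≤ #(I.dom N) ∧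
        ∀ h : (I.dom N).Nonempty, (I.decode N h).Models φ) :
    (bigWeakChainLogic τ κ κ).ChuLE (chainLogic τ κ κ) := by
  classical
  obtain ⟨σ, hσ⟩ := I.exists_models_iff_le_mk_dom hκ hκ₀
  obtain ⟨M₀, hM₀⟩ := exists_weakChainModel_le_mk τ hκ.pos
  have hne {N : WeakChainModel τ} (h : κ ≤ #(I.dom N)) : (I.dom N).Nonempty :=
    Set.nonempty_coe_sort.1 (mk_ne_zero_iff.1 (hκ.pos.trans_le h).ne')
  -- When `σ` fails, the image of `φ` must take the truth value of `φ` in the default model `M₀`;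
  -- hence the two forms.
  refine ⟨⟨fun φ => if M₀.Models φ then σ.neg.or hκ₀.le (I.translate hκ₀.le φ)
      else σ.and hκ₀.le (I.translate hκ₀.le φ),
    fun N => if h : κ ≤ #(I.dom N.1) then ⟨I.decode N.1 (hne h), h⟩ else ⟨M₀, hM₀⟩,
    fun φ N => ?_⟩, fun φ hφ => ?_⟩
  · have hneg : N.1.Models σ.neg ↔ ¬ N.1.Models σ := Iff.rfl
    change N.1.Models (ite _ _ _) ↔ WeakChainModel.Models (Subtype.val (dite _ _ _)) φ
    by_cases h : κ ≤ #(I.dom N.1)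
    · rw [dif_pos h]
      refine Iff.trans ?_ (I.models_translate hκ₀.le N.1 (hne h) φ)
      split_ifs
      · simp [Formula.models_or, hneg, hσ, h]
      · simp [Formula.models_and, hσ, h]
    · rw [dif_neg h]
      split_ifs with h₀
      · simp [Formula.models_or, hneg, hσ, h, h₀]
      · simp [Formula.models_and, hσ, h, h₀]
  · obtain ⟨M, hM⟩ := hφ
    obtain ⟨N, hN, hdom, hφN⟩ := H φ M.1 M.2 hM
    refine ⟨⟨N, hN⟩, ?_⟩
    change WeakChainModel.Models (Subtype.val (dite _ _ _)) φ
    rw [dif_pos hdom]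
    exact hφN (hne hdom)

/-! ### Padding a chain model to a proper chain model -/

namespace WeakChainModel

/-- A strictly increasing sequence of cardinals above the size of `M`. -/
noncomputable def padCard (M : WeakChainModel τ) (n : ℕ) : Cardinal.{u} :=
  Order.succ^[n] (max ℵ₀ #M.carrier)

theorem padCard_strictMono (M : WeakChainModel τ) : StrictMono M.padCard :=
  strictMono_nat_of_lt_succ fun n => by
    rw [padCard, padCard, Function.iterate_succ_apply']
    exact Order.lt_succ _

theorem max_le_padCard (M : WeakChainModel τ) (n : ℕ) : max ℵ₀ #M.carrier ≤ M.padCard n :=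
  M.padCard_strictMono.monotone n.zero_le

/-- The elements added in order to make `M` proper. -/
abbrev Padding (M : WeakChainModel τ) : Type u :=
  Σ n : ℕ, (M.padCard n).out

/-- The extension of `M` by new elements, with new interpretations of the relations. -/
def pad (M : WeakChainModel τ) (r : ∀ R : τ.Rel, (τ.arity R → M.carrier ⊕ M.Padding) → Prop) :
    WeakChainModel τ where
  carrier := M.carrier ⊕ M.Padding
  nonempty := M.nonempty.map Sum.inl
  rel := r
  chain n := Sum.inl '' M.chain n ∪ Sum.inr '' {p | p.1 ≤ n}
  chain_subset_succ n := Set.union_subset_union (Set.image_mono (M.chain_subset_succ n))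
    (Set.image_mono fun _ hp => Nat.le_succ_of_le hp)
  iUnion_chain := by
    refine Set.eq_univ_of_forall ?_
    rintro (x | p)
    · obtain ⟨n, hn⟩ := M.exists_mem_chain x
      exact Set.mem_iUnion.2 ⟨n, .inl ⟨x, hn, rfl⟩⟩
    · exact Set.mem_iUnion.2 ⟨p.1, .inr ⟨p, le_refl p.1, rfl⟩⟩

variable (M : WeakChainModel τ) (r : ∀ R : τ.Rel, (τ.arity R → M.carrier ⊕ M.Padding) → Prop)

theorem inl_mem_chain_pad {n : ℕ} {x : M.carrier} :
    (Sum.inl x : M.carrier ⊕ M.Padding) ∈ (M.pad r).chain n ↔ x ∈ M.chain n := by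
  change _ ∈ (_ ∪ _ : Set (M.carrier ⊕ M.Padding)) ↔ _
  simp

theorem inr_mem_chain_pad {n : ℕ} {p : M.Padding} :
    (Sum.inr p : M.carrier ⊕ M.Padding) ∈ (M.pad r).chain n ↔ p.1 ≤ n := by
  change _ ∈ (_ ∪ _ : Set (M.carrier ⊕ M.Padding)) ↔ _
  simp

/-- The top layer dominates: the old part and each earlier layer are no larger than this infinite
cardinal. -/
theorem mk_chain_pad (n : ℕ) : #((M.pad r).chain n) = M.padCard n := by
  have h₀ := (le_max_left _ _).trans (M.max_le_padCard n)
  apply le_antisymm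
  · refine (mk_union_le _ _).trans (add_le_of_le h₀ ?_ ?_)
    · exact mk_image_le.trans ((mk_set_le _).trans ((le_max_right _ _).trans (M.max_le_padCard n)))
    · refine mk_image_le.trans ?_
      have hle (k : {k // k ≤ n}) : Nonempty ((M.padCard k.1).out ↪ (M.padCard n).out) := by
        rw [← le_def, mk_out, mk_out]
        exact M.padCard_strictMono.monotone k.2
      let f (k : {k // k ≤ n}) := (hle k).some
      calc #{p : M.Padding | p.1 ≤ n} ≤ #(ULift.{u} ℕ × (M.padCard n).out) := by
            refine mk_le_of_injective (f := fun p => (⟨p.1.1⟩, f ⟨p.1.1, p.2⟩ p.1.2)) ?_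
            rintro ⟨⟨k, x⟩, hx⟩ ⟨⟨l, y⟩, hy⟩ h
            simp only [Prod.mk.injEq, ULift.up.injEq] at h
            obtain ⟨rfl, h⟩ := h
            have := (f ⟨k, hx⟩).injective h
            subst this
            rfl
        _ ≤ M.padCard n := by
            simpa using mul_le_of_le h₀ h₀ le_rfl
  · calc M.padCard n = #(M.padCard n).out := (mk_out _).symm
      _ ≤ _ := mk_le_of_injective
        (f := fun x => ⟨Sum.inr ⟨n, x⟩, (M.inr_mem_chain_pad r).2 le_rfl⟩) fun x y h => by
          have := Sum.inr_injective (congrArg Subtype.val h)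
          simpa using this

theorem isProper_pad : (M.pad r).IsProper := fun n => by
  rw [mk_chain_pad, mk_chain_pad]
  exact M.padCard_strictMono n.lt_succ_self

end WeakChainModel

/-- If an interpretation recovers `M` from every padding of it, then it recovers its theory. -/
theorem Interpretation.exists_isProper (I : Interpretation τ κ) (M : WeakChainModel τ)
    (r : ∀ R : τ.Rel, (τ.arity R → M.carrier ⊕ M.Padding) → Prop)
    (hdom : ∀ y : M.carrier ⊕ M.Padding, y ∈ I.dom (M.pad r) ↔ ∃ x, y = Sum.inl x)
    (hrel : ∀ R (x : τ.arity R → M.carrier),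
      I.rel (M.pad r) R (fun i => (Sum.inl (x i) : M.carrier ⊕ M.Padding)) ↔ M.rel R x)
    (φ : Sentence τ κ κ) (hM : κ ≤ #M.carrier) (hφ : M.Models φ) :
    ∃ N : WeakChainModel τ, N.IsProper ∧ κ ≤ #(I.dom N) ∧
        ∀ h : (I.dom N).Nonempty, (I.decode N h).Models φ := by
  let f (x : M.carrier) : I.dom (M.pad r) := ⟨Sum.inl x, (hdom _).2 ⟨x, rfl⟩⟩
  have hf : Function.Bijective f := by
    refine ⟨fun x y h => Sum.inl_injective (congrArg Subtype.val h), ?_⟩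
    rintro ⟨y, hy⟩
    obtain ⟨x, rfl⟩ := (hdom y).1 hy
    exact ⟨x, rfl⟩
  refine ⟨M.pad r, M.isProper_pad r, hM.trans (mk_le_of_injective hf.1), fun h => ?_⟩
  refine (WeakChainModel.models_iff_of_equiv (N := I.decode _ h) (Equiv.ofBijective f hf) hrel
    (fun n => ⟨n, fun x hx => ?_⟩) (fun n => ⟨n, fun x hx => ?_⟩) φ).2 hφ
  · exact (M.inl_mem_chain_pad r).2 hx
  · exact (M.inl_mem_chain_pad r).1 hx

/-! ### Vocabularies with a symbol of arity at least two -/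

open Classical in
/-- The interpretation whose domain is the set of those `x` for which there is `y` such that `R₀`
holds of the tuple with `x` at the place `i₀` and `y` at all other places. -/
noncomputable def Interpretation.ofPlace (hκ : ℵ₀ ≤ κ) (R₀ : τ.Rel) (i₀ : τ.arity R₀) :
    Interpretation τ κ where
  domFormula x := .ex PUnit ((lt_aleph0_of_finite _).trans_le hκ)
    (.rel R₀ fun k => if k = i₀ then .inl x else .inr ⟨⟩)
  relFormula R x := .rel R x
  dom N := {x | ∃ y, N.rel R₀ fun k => if k = i₀ then x else y}
  rel N R x := N.rel R x
  realize_dom N α x a := by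
    simp only [Formula.ChainRealize, apply_ite, Sum.elim_inl, Sum.elim_inr, Set.mem_ofPred_eq]
    refine ⟨fun ⟨_, b, _, h⟩ => ⟨_, h⟩, fun ⟨y, h⟩ => ?_⟩
    obtain ⟨n, hn⟩ := N.exists_mem_chain y
    exact ⟨n, fun _ => y, fun _ => hn, h⟩
  realize_rel N α R x a := Iff.rfl

/-- The added `R₀`-tuples have an old element at `i₀` and a new element `d` elsewhere. They put
exactly the old elements into the domain, and since `d` occurs at a second place, they do not
disturb `R₀` on old tuples. -/
theorem chuLE_of_nontrivial_arity (hκ : κ.IsSingular) (hκ₀ : ℵ₀ < κ) (R₀ : τ.Rel)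
    [Nontrivial (τ.arity R₀)] : (bigWeakChainLogic τ κ κ).ChuLE (chainLogic τ κ κ) := by
  classical
  obtain ⟨i₀, j₀, hij⟩ := exists_pair_ne (τ.arity R₀)
  refine (Interpretation.ofPlace hκ₀.le R₀ i₀).bigWeakChainLogic_chuLE_chainLogic hκ hκ₀
    fun φ M hM hφ => ?_
  let d : M.carrier ⊕ M.Padding := Sum.inr ⟨0, Classical.choice <| mk_ne_zero_iff.1 <| by
    rw [mk_out]
    exact (aleph0_pos.trans_le ((le_max_left _ _).trans (M.max_le_padCard 0))).ne'⟩
  -- Equating dependent pairs says `R = R₀` and `i = i₀` without transporting `i₀` along an equality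
  -- of symbols.
  refine Interpretation.exists_isProper _ M (fun R y => (∃ x, y = Sum.inl ∘ x ∧ M.rel R x) ∨
    ∃ i, (⟨R, i⟩ : Σ R, τ.arity R) = ⟨R₀, i₀⟩ ∧ ∃ x, y = fun k => if k = i then Sum.inl x else d)
    (fun y => ⟨?_, ?_⟩) (fun R x => ⟨?_, fun h => Or.inl ⟨x, rfl, h⟩⟩) φ hM hφ
  · rintro ⟨z, ⟨x, hx, -⟩ | ⟨i, hi, x, hx⟩⟩
    · exact ⟨x i₀, (if_pos rfl).symm.trans (congrFun hx i₀)⟩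
    · obtain rfl : i = i₀ := by simpa using hi
      exact ⟨x, (if_pos rfl).symm.trans ((congrFun hx i).trans (if_pos rfl))⟩
  · rintro ⟨x, rfl⟩
    exact ⟨d, .inr ⟨i₀, rfl, x, rfl⟩⟩
  · rintro (⟨x', hx, h⟩ | ⟨i, hi, x', hx⟩)
    · obtain rfl : x = x' := funext fun i => Sum.inl_injective (congrFun hx i)
      exact h
    · obtain ⟨rfl, hi⟩ := Sigma.mk.inj_iff.1 hi
      obtain rfl := eq_of_heq hi
      have := congrFun hx j₀
      simp [hij.symm, d] at this

/-! ### Vocabularies with infinitely many unary symbols -/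

open Classical in
/-- The interpretation whose domain is defined by the symbol `P`, and which reinterprets the
symbols of nonempty arity by means of the map `e`, the places of each symbol being identified. -/
noncomputable def Interpretation.shift (P : {R : τ.Rel // Nonempty (τ.arity R)})
    (e : {R : τ.Rel // Nonempty (τ.arity R)} → {R : τ.Rel // Nonempty (τ.arity R)}) :
    Interpretation τ κ where
  domFormula x := .rel P.1 fun _ => x
  relFormula R x := if h : Nonempty (τ.arity R) then .rel (e ⟨R, h⟩).1 fun _ => x h.some
    else .rel R x
  dom N := {x | N.rel P.1 fun _ => x}
  rel N R x := if h : Nonempty (τ.arity R) then N.rel (e ⟨R, h⟩).1 fun _ => x h.some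
    else N.rel R x
  realize_dom N α x a := Iff.rfl
  realize_rel N α R x a := by
    split_ifs <;> rfl

theorem chuLE_of_infinite_unary (hκ : κ.IsSingular) (hκ₀ : ℵ₀ < κ)
    (hτ : ∀ R : τ.Rel, Subsingleton (τ.arity R))
    [Infinite {R : τ.Rel // Nonempty (τ.arity R)}] :
    (bigWeakChainLogic τ κ κ).ChuLE (chainLogic τ κ κ) := by
  classical
  obtain ⟨w⟩ : Nonempty (Option {R : τ.Rel // Nonempty (τ.arity R)} ≃
      {R : τ.Rel // Nonempty (τ.arity R)}) := by
    rw [← Cardinal.eq, mk_option, add_one_eq (aleph0_le_mk _)]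
  refine (Interpretation.shift (w none) (w ∘ some)).bigWeakChainLogic_chuLE_chainLogic hκ hκ₀
    fun φ M hM hφ => ?_
  -- The symbol `w none` holds of all old elements, as its last condition is vacuous; `w (some S)`
  -- holds of the old elements satisfying `S`. Nullary symbols keep their truth values.
  let r (R : τ.Rel) (y : τ.arity R → M.carrier ⊕ M.Padding) : Prop :=
    if h : Nonempty (τ.arity R) then
      ∃ x, y h.some = Sum.inl x ∧ ∀ S, w.symm ⟨R, h⟩ = some S → M.rel S.1 fun _ => x
    else M.rel R fun i => (h ⟨i⟩).elim
  have hr (o : Option {R : τ.Rel // Nonempty (τ.arity R)}) (y : M.carrier ⊕ M.Padding) :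
      r (w o).1 (fun _ => y) ↔ ∃ x, y = Sum.inl x ∧ ∀ S, o = some S → M.rel S.1 fun _ => x := by
    simp [r, (w o).2]
  refine Interpretation.exists_isProper _ M r (fun y => ?_) (fun R x => ?_) φ hM hφ
  · exact (hr none y).trans (by simp)
  · by_cases h : Nonempty (τ.arity R)
    · have hx : x = fun _ => x h.some := funext fun i => congrArg x (Subsingleton.elim _ _)
      have := hr (some ⟨R, h⟩) (Sum.inl (x h.some))
      simp only [Interpretation.shift, dif_pos h]
      refine this.trans ?_
      conv_rhs => rw [hx]
      simp
    · simp only [Interpretation.shift, dif_neg h, WeakChainModel.pad, r]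
      exact iff_of_eq (congrArg _ (funext fun i : τ.arity R => (h ⟨i⟩).elim))

/-! ### Vocabularies with finitely many unary symbols -/

/-- The identity interpretation. -/
def Interpretation.refl (τ : Vocabulary.{u}) (hκ : 0 < κ) : Interpretation τ κ where
  domFormula x := .conj PEmpty (by simpa using hκ) PEmpty.elim
  relFormula R x := .rel R x
  dom N := Set.univ
  rel N R x := N.rel R x
  realize_dom N α x a := iff_of_true (fun i : PEmpty => i.elim) trivial
  realize_rel N α R x a := Iff.rfl

namespace WeakChainModel

variable (M : WeakChainModel τ)

/-- The elements that satisfy the same unary relations as `t`. -/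
def sameType (t : M.carrier) : Set M.carrier :=
  {x | ∀ R, M.rel R (fun _ => x) ↔ M.rel R fun _ => t}

/-- The padding of `M` by elements of the same type as `t`. -/
def padType (t : M.carrier) : WeakChainModel τ :=
  M.pad fun R y => M.rel R (Sum.elim id (fun _ => t) ∘ y)

variable {M}

theorem rel_congr_of_sameType (hτ : ∀ R : τ.Rel, Subsingleton (τ.arity R)) {R : τ.Rel}
    {x y : τ.arity R → M.carrier} (h : ∀ i, x i ∈ M.sameType (y i)) :
    M.rel R x ↔ M.rel R y := by
  rcases isEmpty_or_nonempty (τ.arity R) with hR | ⟨⟨i⟩⟩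
  · rw [Subsingleton.elim x y]
  · have hx (x : τ.arity R → M.carrier) : x = fun _ => x i :=
      funext fun j => congrArg x (Subsingleton.elim _ _)
    rw [hx x, hx y]
    exact h i R

end WeakChainModel

/-- If `κ` many elements have the same type as `t`, then fewer than `κ` new elements of this type
can be moved into `M` by an automorphism of the padding that fixes given old elements. -/
theorem WeakChainModel.exists_perm_padType (hκ₀ : ℵ₀ < κ)
    (M : WeakChainModel τ) (t : M.carrier)
    (ht : κ ≤ #(M.sameType t)) {α ι : Type u} (hα : #α < κ) (hι : #ι < κ) (a : α → M.carrier)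
    (b : ι → M.carrier ⊕ M.Padding) {n : ℕ} (hb : ∀ i, b i ∈ (M.padType t).chain n) :
    ∃ (π : Equiv.Perm (M.carrier ⊕ M.Padding)) (m : ℕ) (c : ι → M.carrier),
      (∀ x, π (Sum.inl (a x)) = Sum.inl (a x)) ∧ (∀ i, π (b i) = Sum.inl (c i)) ∧
      (∀ y, π y ≠ y → y ∈ (M.padType t).chain m ∧ π y ∈ (M.padType t).chain m) ∧
      ∀ y, Sum.elim id (fun _ => t) (π y) ∈ M.sameType (Sum.elim id (fun _ => t) y) := by
  -- One chain member holds so many elements of the type of `t` that, with the old elements to be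
  -- fixed (`Z`) removed, there is room for all new elements occurring in `b` (`X`).
  obtain ⟨m, hm⟩ := M.exists_lt_mk_inter hκ₀ ht (max_lt hκ₀ (add_lt_of_lt hκ₀.le hα hι))
  let X : Set M.Padding := {p | ∃ i, b i = Sum.inr p}
  let Z : Set M.carrier := Set.range a ∪ Sum.inl ⁻¹' Set.range b
  have hX : #X ≤ #ι := by
    choose i hi using fun p : X => p.2
    exact mk_le_of_injective (f := i) fun p q h => Subtype.ext
      (Sum.inr_injective ((hi p).symm.trans ((congrArg b h).trans (hi q))))
  have hZ : #Z ≤ #α + #ι := (mk_union_le _ _).trans (add_le_add mk_range_le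
    ((mk_preimage_of_injective _ _ Sum.inl_injective).trans mk_range_le))
  obtain ⟨j⟩ : Nonempty (X ↪ ((M.chain m ∩ M.sameType t) \ Z : Set M.carrier)) := by
    rw [← le_def]
    by_contra! hlt
    refine hm.not_ge ((mk_le_mk_of_subset (Set.subset_sdiff_union _ Z)).trans
      ((mk_union_le _ _).trans (add_le_of_le (le_max_left _ _) ?_ (hZ.trans (le_max_right _ _)))))
    exact hlt.le.trans (hX.trans ((self_le_add_left _ _).trans (le_max_right _ _)))
  let f : X ⊕ X ↪ M.carrier ⊕ M.Padding := ⟨Sum.elim (fun p => Sum.inr p.1) fun p => Sum.inl (j p),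
    by
      rintro (p | p) (q | q) h
      · exact congrArg _ (Subtype.ext (Sum.inr_injective h))
      · cases h
      · cases h
      · exact congrArg _ (j.injective (Subtype.ext (Sum.inl_injective h)))⟩
  -- `π` exchanges each new element of `b` with its chosen old partner and fixes everything else.
  let π : Equiv.Perm (M.carrier ⊕ M.Padding) :=
    Equiv.Perm.viaEmbedding (Equiv.sumComm X X) f
  have hπ₁ (p : X) : π (Sum.inr p.1) = Sum.inl (j p).1 :=
    Equiv.Perm.viaEmbedding_apply (Equiv.sumComm X X) f (Sum.inl p)
  have hπ₂ (p : X) : π (Sum.inl (j p).1) = Sum.inr p.1 :=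
    Equiv.Perm.viaEmbedding_apply (Equiv.sumComm X X) f (Sum.inr p)
  have hπ₃ (y : M.carrier ⊕ M.Padding) (hy : y ∉ Set.range f) : π y = y :=
    Equiv.Perm.viaEmbedding_apply_of_notMem (Equiv.sumComm X X) f y hy
  have hπ₄ (x : M.carrier) (hx : x ∈ Z) : π (Sum.inl x) = Sum.inl x := by
    refine hπ₃ _ ?_
    rintro ⟨p | p, hp⟩
    · cases hp
    · exact (j p).2.2 (Sum.inl_injective hp ▸ hx)
  have hf₁ (p : X) : Sum.inr p.1 ∈ (M.padType t).chain (max n m) := by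
    obtain ⟨i, hi⟩ := p.2
    exact (M.padType t).chain_mono (le_max_left n m) (hi ▸ hb i)
  have hf₂ (p : X) : Sum.inl (j p).1 ∈ (M.padType t).chain (max n m) :=
    (M.padType t).chain_mono (le_max_right n m) ((M.inl_mem_chain_pad _).2 (j p).2.1.1)
  have hc (i : ι) : ∃ x, π (b i) = Sum.inl x := by
    rcases hbi : b i with x | p
    · exact ⟨x, hπ₄ x (.inr ⟨i, hbi⟩)⟩
    · exact ⟨_, hπ₁ ⟨p, i, hbi⟩⟩
  choose c hc using hc
  refine ⟨π, max n m, c, fun x => hπ₄ _ (.inl ⟨x, rfl⟩), hc, fun y hy => ?_, fun y => ?_⟩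
  · obtain ⟨p | p, rfl⟩ := not_imp_comm.1 (hπ₃ y) hy
    · exact ⟨hf₁ p, (hπ₁ p).symm ▸ hf₂ p⟩
    · exact ⟨hf₂ p, (hπ₂ p).symm ▸ hf₁ p⟩
  · by_cases hy : y ∈ Set.range f
    · obtain ⟨p | p, rfl⟩ := hy
      · change Sum.elim id _ (π (Sum.inr p.1)) ∈ _
        rw [hπ₁]
        exact (j p).2.1.2
      · change Sum.elim id _ (π (Sum.inl (j p).1)) ∈ _
        rw [hπ₂]
        exact fun R => ((j p).2.1.2 R).symm
    · rw [hπ₃ y hy]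
      exact fun R => Iff.rfl

/-- If `κ` many elements have the same type as `t`, then the padding of `M` by elements of this
type is an elementary extension. -/
theorem Formula.chainRealize_padType (hκ₀ : ℵ₀ < κ)
    (hτ : ∀ R : τ.Rel, Subsingleton (τ.arity R)) (M : WeakChainModel τ) (t : M.carrier)
    (ht : κ ≤ #(M.sameType t)) {α : Type u} (hα : #α < κ) (φ : Formula τ κ κ α)
    (a : α → M.carrier) :
    φ.ChainRealize (M.padType t) (Sum.inl ∘ a : α → M.carrier ⊕ M.Padding) ↔
      φ.ChainRealize M a := by
  induction φ with
  | eq x y => exact Sum.inl_injective.eq_iff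
  | rel R x => rfl
  | neg φ ih => exact not_congr (ih hα a)
  | conj ι hι φ ih => exact forall_congr' fun i => ih i hα a
  | disj ι hι φ ih => exact exists_congr fun i => ih i hα a
  | @ex α ι hι φ ih =>
    have hαι : #(α ⊕ ι) < κ := by simpa using add_lt_of_lt hκ₀.le hα hι
    constructor
    · rintro ⟨n, b, hb, hφ⟩
      -- As in the Tarski–Vaught test, witnesses are moved into `M` over the parameters. `π` need
      -- not preserve the individual chain members, but it moves points only inside one of them, so
      -- it preserves boundedness, and that is all chain truth depends on.
      obtain ⟨π, m, c, ha, hc, hm, hπ⟩ := M.exists_perm_padType hκ₀ t ht hα hι a b hb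
      have hbound (l : ℕ) (y : M.carrier ⊕ M.Padding)
          (h : y ∈ (M.padType t).chain l ∨ π y ∈ (M.padType t).chain l) :
          y ∈ (M.padType t).chain (max l m) ∧ π y ∈ (M.padType t).chain (max l m) := by
        by_cases hy : π y = y
        · have := (M.padType t).chain_mono (le_max_left l m) (h.elim id fun h => hy ▸ h)
          exact ⟨this, hy.symm ▸ this⟩
        · exact (hm y hy).imp (fun h => (M.padType t).chain_mono (le_max_right l m) h)
            fun h => (M.padType t).chain_mono (le_max_right l m) h
      have key := chainRealize_equiv (M := M.padType t) (N := M.padType t) π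
        (fun R x => WeakChainModel.rel_congr_of_sameType hτ fun i => hπ (x i))
        (fun l => ⟨_, fun x hx => (hbound l x (.inl hx)).2⟩)
        (fun l => ⟨_, fun x hx => (hbound l x (.inr hx)).1⟩) φ
      refine ⟨max n m, c, fun i => ?_, (ih hαι _).1 ?_⟩
      · have := (hbound n _ (.inl (hb i))).2
        rw [hc i] at this
        exact (M.inl_mem_chain_pad _).1 this
      · refine Eq.mp (congrArg _ (funext fun x => ?_)) ((key _).2 hφ)
        rcases x with x | i
        · exact ha x
        · exact hc i
    · rintro ⟨n, b, hb, hφ⟩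
      refine ⟨n, Sum.inl ∘ b, fun i => (M.inl_mem_chain_pad _).2 (hb i), ?_⟩
      exact Eq.mp (congrArg _ (Sum.comp_elim _ _ _)) ((ih hαι _).2 hφ)

/-- There are finitely many types, fewer than the cofinality of `κ`, so by pigeonhole one is
realized `κ` times. The whole padding by clones of it serves as the interpreted model. -/
theorem chuLE_of_finite_unary (hκ : κ.IsSingular) (hκ₀ : ℵ₀ < κ) (hcof : κ.ord.cof = ℵ₀)
    (hτ : ∀ R : τ.Rel, Subsingleton (τ.arity R))
    [Finite {R : τ.Rel // Nonempty (τ.arity R)}] :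
    (bigWeakChainLogic τ κ κ).ChuLE (chainLogic τ κ κ) := by
  refine (Interpretation.refl τ hκ.pos).bigWeakChainLogic_chuLE_chainLogic hκ hκ₀
    fun φ M hM hφ => ?_
  let T (x : M.carrier) : ULift.{u} ({R : τ.Rel // Nonempty (τ.arity R)} → Prop) :=
    ⟨fun R => M.rel R.1 fun _ => x⟩
  obtain ⟨p, hp⟩ := infinite_pigeonhole_card T κ hM hκ₀.le
    (by rw [hcof]; exact lt_aleph0_of_finite _)
  obtain ⟨⟨t, rfl⟩⟩ := mk_ne_zero_iff.1 (hκ.pos.trans_le hp).ne'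
  have hsub : T ⁻¹' {T t} ⊆ M.sameType t := fun x hx R => by
    rcases isEmpty_or_nonempty (τ.arity R) with hR | hR
    · rw [Subsingleton.elim (fun _ : τ.arity R => x) fun _ => t]
    · exact iff_of_eq (congrFun (congrArg ULift.down hx) ⟨R, hR⟩)
  have ht := hp.trans (mk_le_mk_of_subset hsub)
  have hmodels : (M.padType t).Models φ := by
    exact Eq.mp (congrArg (φ.ChainRealize _) (Subsingleton.elim _ _))
      ((Formula.chainRealize_padType hκ₀ hτ M t ht
      (by simpa using hκ.pos) φ PEmpty.elim).2 hφ)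
  refine ⟨M.padType t, M.isProper_pad _, ?_, fun h => ?_⟩
  · change κ ≤ #(Set.univ : Set (M.carrier ⊕ M.Padding))
    rw [mk_univ]
    exact hM.trans (mk_le_of_injective Sum.inl_injective)
  · exact (WeakChainModel.models_iff_of_equiv (M := M.padType t)
      (Equiv.Set.univ _).symm (fun _ _ => Iff.rfl) (fun n => ⟨n, fun _ hx => hx⟩)
      (fun n => ⟨n, fun _ hx => hx⟩) φ).2 hmodels

theorem bigWeakChainLogic_chuLE_chainLogic (hκ : κ.IsSingular) (hκ₀ : ℵ₀ < κ)
    (hcof : κ.ord.cof = ℵ₀) : (bigWeakChainLogic τ κ κ).ChuLE (chainLogic τ κ κ) := by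
  by_cases hτ : ∀ R : τ.Rel, Subsingleton (τ.arity R)
  · rcases finite_or_infinite {R : τ.Rel // Nonempty (τ.arity R)} with _ | _
    · exact chuLE_of_finite_unary hκ hκ₀ hcof hτ
    · exact chuLE_of_infinite_unary hκ hκ₀ hτ
  · push Not at hτ
    obtain ⟨R₀, hR₀⟩ := hτ
    exact chuLE_of_nontrivial_arity hκ hκ₀ R₀

end ChainLogic

theorem theorem3p5 (τ : ChainLogic.Vocabulary.{u}) (hτ : Countable τ.Rel)
    (κ : Cardinal.{u}) (hκ : κ.IsSingular) (hcof : κ.ord.cof = ℵ₀)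
    (harity : ∀ R : τ.Rel, #(τ.arity R) < κ) :
    (ChainLogic.ordLogic τ κ ℵ₀).ChuLE (ChainLogic.weakChainLogic τ κ κ) ∧
    (κ.IsStrongLimit →
      (ChainLogic.bigOrdLogic τ κ ℵ₀).ChuLE (ChainLogic.chainLogic τ κ κ)) ∧
    (ChainLogic.bigWeakChainLogic τ κ κ).ChuLE (ChainLogic.chainLogic τ κ κ) := by
  have hκ₀ : ℵ₀ < κ := hcof ▸ hκ.cof_ord_lt
  have h := ChainLogic.bigWeakChainLogic_chuLE_chainLogic (τ := τ) hκ hκ₀ hcof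
  exact ⟨ChainLogic.ordLogicOn_chuLE_chainLogicOn hκ₀.le _,
    fun _ => (ChainLogic.ordLogicOn_chuLE_chainLogicOn hκ₀.le _).trans h, h⟩
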